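/- Let $\lambda_E$ denote the uniform probability measure on a Borel set $E\subset\mathbb R^n$ with $0<|E|<\infty$. For a probability measure $\mu$ on $\mathbb R^n$ let $\mu^+(A)=\liminf_{\varepsilon\to0^+}\frac{\mu(A_\varepsilon)-\mu(A)}{\varepsilon}$ with $A_\varepsilon=\{x:\mathrm{dist}(x,A)<\varepsilon\}$, and let the Cheeger constant $D_{\mathrm{Che}}(\mu)$ be the largest $h$ with $\mu^+(A)\ge h\min\{\mu(A),1-\mu(A)\}$ for all Borel sets $A$. For a cost $c\ge 0$ let $\mathcal W_c(\mu,\nu)=\inf_\pi\iint c(x,y)\,d\pi(x,y)$ over all couplings $\pi$ of $\mu$ and $\nu$, and let $W_1=\mathcal W_c$ for $c(x,y)=|x-y|$. Put $\mathcal F(t)=t-\log(1+t)$ for $t\ge0$, $c_\mu(x,y)=\mathcal F(D_{\mathrm{Che}}(\mu)|x-y|)$, and $\widetilde E=|E|^{-1/n}E$. Let $p_K(E)=\liminf_{\varepsilon\to0^+}\frac{|E+\varepsilon K|-|E|}{\varepsilon}$, $R(E,K)=\frac{p_K(E)}{n|K|^{1/n}|E|^{1-1/n}}-1$, and $A_K(E)=\inf\left\{\frac{|E\,\Delta\,(x_0+rK)|}{|E|}: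 x_0\in\mathbb R^n,\ r>0,\ r^n|K|=|E|\right\}$. For $\alpha>0$ consider in $\mathbb R^2$ the rectangles $$E_\alpha=\left[-\tfrac{\alpha}{2},\tfrac{\alpha}{2}\right]\times\left[-\tfrac1{2\alpha},\tfrac1{2\alpha}\right],\qquad K_\alpha=\left[-\tfrac{\alpha^2}{2},\tfrac{\alpha^2}{2}\right]\times\left[-\tfrac1{2\alpha^2},\tfrac1{2\alpha^2}\right].$$ Then $$\lim_{\alpha\to+\infty}D_{\mathrm{Che}}(\lambda_{E_\alpha})\,W_1(\lambda_{E_\alpha},\lambda_{K_\alpha})=+\infty .$$ Hence, with $n=2$, for every constant $c>0$ the transport remainders $$\frac cn\,\mathcal F\big(D_{\mathrm{Che}}(\lambda_{E_\alpha})W_1(\lambda_{E_\alpha},\lambda_{K_\alpha})\big)\quad\text{and}\quad \frac cn\,\mathcal W_{c_{\lambda_{\widetilde E_\alpha}}}(\lambda_{\widetilde E_\alpha},\lambda_{\widetilde K_\alpha})$$ tend to $+\infty$ as $\alpha\to+\infty$, and so does $R(E_\alpha,K_\alpha)$; whereas for every constant $C\ge 0$ the Figalli--Maggi--Pratelli remainder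 $\frac{C}{n^7}A_{K_\alpha}(E_\alpha)^2$ stays bounded over all $\alpha>0$. -/

import Mathlib

open MeasureTheory Filter Topology Set
open scoped ENNReal NNReal Pointwise

namespace QuantIso

noncomputable section

/-- The uniform probability measure `λ_E` on `E ⊆ ℝⁿ`: normalized restricted Lebesgue measure. -/
def unif {n : ℕ} (E : Set (EuclideanSpace ℝ (Fin n))) : Measure (EuclideanSpace ℝ (Fin n)) :=
  (volume E)⁻¹ • volume.restrict E

/-- The Minkowski content `μ⁺(A) = liminf_{ε → 0⁺} (μ(A_ε) - μ(A)) / ε`, where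
`A_ε = {x | dist(x, A) < ε}`. -/
def minkowskiContent {n : ℕ} (μ : Measure (EuclideanSpace ℝ (Fin n)))
    (A : Set (EuclideanSpace ℝ (Fin n))) : ℝ≥0∞ :=
  liminf (fun ε : ℝ => (μ (Metric.thickening ε A) - μ A) / ENNReal.ofReal ε) (𝓝[>] 0)

/-- The Cheeger constant `D_Che(μ)`: the largest `h` such that
`h * min (μ A) (1 - μ A) ≤ μ⁺(A)` for all Borel sets `A`. -/
def cheeger {n : ℕ} (μ : Measure (EuclideanSpace ℝ (Fin n))) : ℝ≥0∞ :=
  sSup {h : ℝ≥0∞ | ∀ A : Set (EuclideanSpace ℝ (Fin n)), MeasurableSet A →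
    h * min (μ A) (1 - μ A) ≤ minkowskiContent μ A}

/-- The transportation cost `W_c(μ, ν)`: infimum of `∬ c(x, y) dπ(x, y)` over all `π` with
marginals `μ` and `ν`. -/
def transportCost {n : ℕ}
    (c : EuclideanSpace ℝ (Fin n) → EuclideanSpace ℝ (Fin n) → ℝ≥0∞)
    (μ ν : Measure (EuclideanSpace ℝ (Fin n))) : ℝ≥0∞ :=
  ⨅ (π : Measure (EuclideanSpace ℝ (Fin n) × EuclideanSpace ℝ (Fin n)))
    (_ : π.map Prod.fst = μ) (_ : π.map Prod.snd = ν), ∫⁻ p, c p.1 p.2 ∂π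

/-- The Wasserstein distance `W₁`, for the Euclidean distance. -/
def W1 {n : ℕ} (μ ν : Measure (EuclideanSpace ℝ (Fin n))) : ℝ≥0∞ :=
  transportCost (fun x y => edist x y) μ ν

/-- `F(t) = t - log (1 + t)` on `[0, ∞]`, with `F(∞) = ∞`. -/
def costF (t : ℝ≥0∞) : ℝ≥0∞ :=
  if t = ⊤ then ⊤ else ENNReal.ofReal (t.toReal - Real.log (1 + t.toReal))

/-- The cost `c_μ(x, y) = F(D_Che(μ) |y - x|)`. -/
def cheegerCost {n : ℕ} (μ : Measure (EuclideanSpace ℝ (Fin n)))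
    (x y : EuclideanSpace ℝ (Fin n)) : ℝ≥0∞ :=
  costF (cheeger μ * edist x y)

/-- The volume one homothetic copy `|E|^{-1/n} E` of `E`. -/
def normalized {n : ℕ} (E : Set (EuclideanSpace ℝ (Fin n))) : Set (EuclideanSpace ℝ (Fin n)) :=
  ((volume E).toReal ^ (-(1 / (n : ℝ)))) • E

/-- The transport remainder `(c / n) W_{c_μ}(μ, ν)`, where `μ`, `ν` are uniform on the volume one
copies of `E`, `K`. -/
def costRemainder {n : ℕ} (c : ℝ≥0) (E K : Set (EuclideanSpace ℝ (Fin n))) : ℝ≥0∞ :=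
  (c : ℝ≥0∞) / (n : ℝ≥0∞) *
    transportCost (cheegerCost (unif (normalized E))) (unif (normalized E)) (unif (normalized K))

/-- The remainder `(c / n) F(D_Che(λ_E) W₁(λ_E, λ_K))`. -/
def distRemainder {n : ℕ} (c : ℝ≥0) (E K : Set (EuclideanSpace ℝ (Fin n))) : ℝ≥0∞ :=
  (c : ℝ≥0∞) / (n : ℝ≥0∞) * costF (cheeger (unif E) * W1 (unif E) (unif K))

/-- The anisotropic perimeter `p_K(E) = liminf_{ε → 0⁺} (|E + ε K| - |E|) / ε`. -/
def perimeter {n : ℕ} (K E : Set (EuclideanSpace ℝ (Fin n))) : ℝ≥0∞ :=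
  liminf (fun ε : ℝ => (volume (E + ε • K) - volume E) / ENNReal.ofReal ε) (𝓝[>] 0)

/-- The isoperimetric deficit `R(E, K) = p_K(E) / (n |K|^{1/n} |E|^{1 - 1/n}) - 1`. -/
def deficit {n : ℕ} (E K : Set (EuclideanSpace ℝ (Fin n))) : ℝ :=
  (perimeter K E).toReal /
    (n * (volume K).toReal ^ (1 / (n : ℝ)) * (volume E).toReal ^ (1 - 1 / (n : ℝ))) - 1

/-- The asymmetry index
`A_K(E) = inf {|E Δ (x₀ + r K)| / |E| : x₀ ∈ ℝⁿ, r > 0, r^n |K| = |E|}`. -/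
def asymmetry {n : ℕ} (K E : Set (EuclideanSpace ℝ (Fin n))) : ℝ≥0∞ :=
  ⨅ (x₀ : EuclideanSpace ℝ (Fin n)) (r : ℝ) (_ : 0 < r)
    (_ : ENNReal.ofReal r ^ n * volume K = volume E),
    volume (symmDiff E (x₀ +ᵥ r • K)) / volume E

/-- The Figalli-Maggi-Pratelli remainder `(C / n^7) A_K(E)^2`. -/
def fmpRemainder {n : ℕ} (C : ℝ≥0) (E K : Set (EuclideanSpace ℝ (Fin n))) : ℝ≥0∞ :=
  (C : ℝ≥0∞) / (n : ℝ≥0∞) ^ 7 * asymmetry K E ^ 2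

/-- The rectangle `E_α = [-α/2, α/2] × [-1/(2α), 1/(2α)]`. -/
def rectE (α : ℝ) : Set (EuclideanSpace ℝ (Fin 2)) :=
  {x | x 0 ∈ Icc (-(α / 2)) (α / 2) ∧ x 1 ∈ Icc (-(1 / (2 * α))) (1 / (2 * α))}

/-- The rectangle `K_α = [-α²/2, α²/2] × [-1/(2α²), 1/(2α²)]`. -/
def rectK (α : ℝ) : Set (EuclideanSpace ℝ (Fin 2)) :=
  {x | x 0 ∈ Icc (-(α ^ 2 / 2)) (α ^ 2 / 2) ∧
    x 1 ∈ Icc (-(1 / (2 * α ^ 2))) (1 / (2 * α ^ 2))}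

end

end QuantIso

/-!
Two random points of a convex set `E` bound its Cheeger constant from below. A segment in `E` from
`A` to a point outside `A_ε` spends length at least `ε` in `A_ε \ A`. On the other hand, for fixed
`s ∈ [0, 1]`, the point dividing a random segment of `E` in the ratio `s` is, once the farther
endpoint is fixed, the image of a uniform point under a homothety of ratio at least `1 / 2`, so it
hits `A_ε \ A` with probability at most `2 ^ n * λ_E (A_ε \ A)`. Integrating over `s` gives
`ε * λ_E A * λ_E (A_ε)ᶜ ≤ 2 ^ n * diam E * λ_E (A_ε \ A)`, hence
`D_Che(λ_E) ≥ 1 / (2 ^ (n + 1) * diam E)`.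

For the rectangles this bound is of order `1 / α`, while a quarter of the mass of `λ_{K_α}` lies at
distance of order `α ^ 2` from `E_α`, so `D_Che * W₁` grows at least linearly in `α`. Both transport
remainders inherit the divergence through `t ≤ 2 * F(t) + 1`, and `R(E_α, K_α)` diverges because
`p_{K_α}(E_α) = α + 1 / α`. In contrast, `A_K(E) ≤ 2` always.
-/

namespace QuantIso

section Convex

theorem exists_Ioo_subset_thickening_sdiff {S : Set ℝ} {δ x z : ℝ} (hx : x ∈ S) (hxz : x ≤ z)
    (hz : z ∉ Metric.thickening δ S) :
    ∃ p, x ≤ p ∧ p + δ ≤ z ∧ Ioo p (p + δ) ⊆ Metric.thickening δ S \ S := by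
  have hδ : ∀ s ∈ S, s ≤ z → s ≤ z - δ := by
    intro s hs hsz
    by_contra! h
    refine hz (Metric.mem_thickening_iff.2 ⟨s, hs, ?_⟩)
    rw [Real.dist_eq, abs_of_nonneg (sub_nonneg.2 hsz)]
    linarith
  have hne : (S ∩ Icc x z).Nonempty := ⟨x, hx, le_rfl, hxz⟩
  have hlub := isLUB_csSup hne ⟨z, fun _ hs => hs.2.2⟩
  set p := sSup (S ∩ Icc x z)
  have hxp : x ≤ p := hlub.1 ⟨hx, le_rfl, hxz⟩
  have hpz : p ≤ z - δ := hlub.2 fun s hs => hδ s hs.1 hs.2.2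
  refine ⟨p, hxp, by linarith, fun y hy => ⟨?_, fun hyS => ?_⟩⟩
  · obtain ⟨s, hs, hys, hsp⟩ := hlub.exists_between (show y - δ < p by linarith [hy.2])
    refine Metric.mem_thickening_iff.2 ⟨s, hs.1, ?_⟩
    rw [Real.dist_eq, abs_of_pos (by linarith [hy.1])]
    linarith
  · exact hy.1.not_ge (hlub.1 ⟨hyS, hxp.trans hy.1.le, by linarith [hy.2]⟩)

variable {V : Type*} [NormedAddCommGroup V] [NormedSpace ℝ V]

theorem ofReal_le_edist_mul_volume_preimage_lineMap {A : Set V} {ε : ℝ} {x y : V} (hε : 0 < ε)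
    (hx : x ∈ A) (hy : y ∉ Metric.thickening ε A) :
    ENNReal.ofReal ε ≤ edist x y * volume.restrict (Icc (0 : ℝ) 1)
      (AffineMap.lineMap x y ⁻¹' (Metric.thickening ε A \ A)) := by
  have hxy : 0 < dist x y := dist_pos.2 fun h => hy (h ▸ Metric.self_subset_thickening hε A hx)
  set S : Set ℝ := AffineMap.lineMap x y ⁻¹' A
  have hthick : Metric.thickening (ε / dist x y) S ⊆
      AffineMap.lineMap x y ⁻¹' Metric.thickening ε A := by
    intro t ht
    obtain ⟨s, hs, hts⟩ := Metric.mem_thickening_iff.1 ht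
    refine Metric.mem_thickening_iff.2 ⟨_, hs, ?_⟩
    rwa [dist_lineMap_lineMap, ← lt_div_iff₀ hxy]
  obtain ⟨p, hp0, hp1, hp⟩ := exists_Ioo_subset_thickening_sdiff (S := S) (x := 0) (z := 1)
    (by simpa [S] using hx) zero_le_one fun h => hy (by simpa using hthick h)
  calc ENNReal.ofReal ε = edist x y * volume (Ioo p (p + ε / dist x y)) := by
        rw [edist_dist, Real.volume_Ioo, add_sub_cancel_left, ← ENNReal.ofReal_mul hxy.le,
          mul_div_cancel₀ _ hxy.ne']
    _ ≤ edist x y * volume ((AffineMap.lineMap x y ⁻¹' (Metric.thickening ε A \ A)) ∩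
          Icc (0 : ℝ) 1) := by
        gcongr
        exact fun t ht => ⟨⟨hthick (hp ht).1, (hp ht).2⟩, hp0.trans ht.1.le, ht.2.le.trans hp1⟩
    _ ≤ _ := mul_le_mul_right (Measure.le_restrict_apply _ _) _

variable [FiniteDimensional ℝ V] [MeasurableSpace V] [BorelSpace V] (μ : Measure V)
  [μ.IsAddHaarMeasure]

theorem addHaar_restrict_setOf_lineMap_mem_le {E B : Set V} (hE : Convex ℝ E)
    (hB : MeasurableSet B) {y : V} (hy : y ∈ E) {r : ℝ} (hr : r ∈ Icc (1 / 2) 1) :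
    μ.restrict E {x | AffineMap.lineMap y x r ∈ B} ≤
      2 ^ Module.finrank ℝ V * μ.restrict E B := by
  set d := Module.finrank ℝ V
  have hr0 : 0 ≤ r := by linarith [hr.1]
  have hset : {x | AffineMap.lineMap y x r ∈ B} = AffineMap.homothety y r ⁻¹' B := by
    ext x
    rw [mem_preimage, AffineMap.homothety_eq_lineMap, mem_ofPred_eq]
  have hsub : AffineMap.homothety y r '' (AffineMap.homothety y r ⁻¹' B ∩ E) ⊆ B ∩ E := by
    rintro _ ⟨x, ⟨hxB, hxE⟩, rfl⟩
    refine ⟨hxB, ?_⟩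
    rw [AffineMap.homothety_eq_lineMap]
    exact hE.lineMap_mem hy hxE ⟨hr0, hr.2⟩
  have hone : 1 ≤ 2 ^ d * ENNReal.ofReal |r ^ d| := by
    rw [abs_of_nonneg (by positivity), ENNReal.ofReal_pow hr0, ← mul_pow, ← ENNReal.ofReal_ofNat,
      ← ENNReal.ofReal_mul zero_le_two]
    exact one_le_pow₀ (ENNReal.one_le_ofReal.2 (by linarith [hr.1]))
  rw [hset, Measure.restrict_apply ((AffineMap.homothety_continuous y r).measurable hB),
    Measure.restrict_apply hB]
  calc μ (AffineMap.homothety y r ⁻¹' B ∩ E)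
      ≤ 2 ^ d * ENNReal.ofReal |r ^ d| * μ (AffineMap.homothety y r ⁻¹' B ∩ E) :=
        le_mul_of_one_le_left' hone
    _ = 2 ^ d * μ (AffineMap.homothety y r '' (AffineMap.homothety y r ⁻¹' B ∩ E)) := by
        rw [Measure.addHaar_image_homothety, mul_assoc]
    _ ≤ 2 ^ d * μ (B ∩ E) := by gcongr

theorem prod_restrict_setOf_lineMap_mem_le {E B : Set V} (hE : Convex ℝ E)
    (hB : MeasurableSet B) {s : ℝ} (hs : s ∈ Icc (0 : ℝ) 1) :
    (μ.restrict E).prod (μ.restrict E) {p | AffineMap.lineMap p.1 p.2 s ∈ B} ≤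
      2 ^ Module.finrank ℝ V * μ.restrict E B * μ E := by
  have hmeas : MeasurableSet {p : V × V | AffineMap.lineMap p.1 p.2 s ∈ B} :=
    (continuous_fst.lineMap continuous_snd continuous_const).measurable hB
  have hmem : ∀ᵐ x ∂μ.restrict E, x ∈ E := ae_restrict_mem₀ (hE.nullMeasurableSet μ)
  have hbound : ∀ f : V → ℝ≥0∞,
      (∀ z ∈ E, f z ≤ 2 ^ Module.finrank ℝ V * μ.restrict E B) →
      ∫⁻ z in E, f z ∂μ ≤ 2 ^ Module.finrank ℝ V * μ.restrict E B * μ E := by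
    intro f hf
    rw [← setLIntegral_const]
    exact lintegral_mono_ae (hmem.mono hf)
  -- Fix the endpoint farther from the point `lineMap x y s`: the map from the other endpoint to
  -- this point is then a homothety of ratio at least `1 / 2`.
  rcases le_total s (1 / 2) with h | h
  · rw [Measure.prod_apply_symm hmeas]
    refine hbound _ fun y hy => ?_
    have hr : 1 - s ∈ Icc (1 / 2) 1 := ⟨by linarith, by linarith [hs.1]⟩
    simpa only [AffineMap.lineMap_apply_one_sub, preimage_ofPred_eq] using
      addHaar_restrict_setOf_lineMap_mem_le μ hE hB hy hr
  · rw [Measure.prod_apply hmeas]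
    exact hbound _ fun x hx => addHaar_restrict_setOf_lineMap_mem_le μ hE hB hx ⟨h, hs.2⟩

theorem ofReal_mul_restrict_mul_le_of_convex {E A : Set V} (hE : Convex ℝ E)
    (hA : MeasurableSet A) {ε : ℝ} (hε : 0 < ε) :
    ENNReal.ofReal ε * (μ.restrict E A * μ.restrict E (Metric.thickening ε A)ᶜ) ≤
      Metric.ediam E * (2 ^ Module.finrank ℝ V *
        μ.restrict E (Metric.thickening ε A \ A) * μ E) := by
  set T := Metric.thickening ε A
  set ν := μ.restrict E
  have hT : MeasurableSet T := Metric.isOpen_thickening.measurableSet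
  have hmeas : MeasurableSet {q : (V × V) × ℝ | AffineMap.lineMap q.1.1 q.1.2 q.2 ∈ T \ A} :=
    (Continuous.lineMap (by fun_prop) (by fun_prop) (by fun_prop)).measurable (hT.diff hA)
  have hmem : ∀ᵐ p ∂ν.prod ν, p ∈ E ×ˢ E := by
    have hν : ∀ᵐ x ∂ν, x ∈ E := ae_restrict_mem₀ (hE.nullMeasurableSet μ)
    exact (Measure.quasiMeasurePreserving_fst.ae hν).and
      (Measure.quasiMeasurePreserving_snd.ae hν)
  let exposure : V × V → ℝ≥0∞ := fun p =>
    volume.restrict (Icc (0 : ℝ) 1) (AffineMap.lineMap p.1 p.2 ⁻¹' (T \ A))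
  calc ENNReal.ofReal ε * (ν A * ν Tᶜ)
      = ∫⁻ _ in A ×ˢ Tᶜ, ENNReal.ofReal ε ∂ν.prod ν := by
        rw [setLIntegral_const, Measure.prod_prod]
    _ ≤ ∫⁻ p in A ×ˢ Tᶜ, Metric.ediam E * exposure p ∂ν.prod ν := by
        refine setLIntegral_mono_ae' (hA.prod hT.compl) (hmem.mono fun p hpE hp => ?_)
        refine (ofReal_le_edist_mul_volume_preimage_lineMap hε hp.1 hp.2).trans ?_
        exact mul_le_mul_left (Metric.edist_le_ediam_of_mem hpE.1 hpE.2) _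
    _ ≤ ∫⁻ p, Metric.ediam E * exposure p ∂ν.prod ν := setLIntegral_le_lintegral _ _
    _ = Metric.ediam E * ∫⁻ p, exposure p ∂ν.prod ν :=
        lintegral_const_mul _ (measurable_measure_prodMk_left hmeas)
    _ = Metric.ediam E * ∫⁻ s in Icc (0 : ℝ) 1,
          ν.prod ν {p | AffineMap.lineMap p.1 p.2 s ∈ T \ A} := by
        congr 1
        exact (Measure.prod_apply hmeas).symm.trans (Measure.prod_apply_symm hmeas)
    _ ≤ Metric.ediam E * ∫⁻ _ in Icc (0 : ℝ) 1,
          2 ^ Module.finrank ℝ V * ν (T \ A) * μ E := by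
        gcongr 1
        exact setLIntegral_mono' measurableSet_Icc fun s hs =>
          prod_restrict_setOf_lineMap_mem_le μ hE (hT.diff hA) hs
    _ = _ := by simp

end Convex

section Cheeger

variable {n : ℕ}

theorem min_le_two_mul_mul {x y : ℝ≥0∞} (h : 1 ≤ x + y) : min x y ≤ 2 * (x * y) :=
  calc min x y ≤ min x y * (x + y) := le_mul_of_one_le_right' h
    _ = min x y * x + min x y * y := mul_add _ _ _
    _ ≤ y * x + x * y := by gcongr <;> simp
    _ = 2 * (x * y) := by ring

theorem mul_min_le_of_mul_measure_compl_le {Ω : Type*} [MeasurableSpace Ω] {μ : Measure Ω}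
    [IsProbabilityMeasure μ] {A T : Set Ω} {e k : ℝ≥0∞} (hA : MeasurableSet A)
    (hT : MeasurableSet T) (hAT : A ⊆ T) (h : e * (μ A * μ Tᶜ) ≤ k * μ (T \ A)) :
    e * min (μ A) (1 - μ A) ≤ (2 * k + 2 * e) * μ (T \ A) := by
  have hsplit : 1 - μ A = μ Tᶜ + μ (T \ A) := by
    rw [← prob_compl_eq_one_sub hA, add_comm, ← measure_inter_add_sdiff Aᶜ hT, inter_comm,
      ← sdiff_eq, sdiff_eq Aᶜ, inter_eq_self_of_subset_right (compl_subset_compl.2 hAT)]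
  calc e * min (μ A) (1 - μ A)
      ≤ e * (2 * (μ A * (μ Tᶜ + μ (T \ A)))) := by
        rw [← hsplit]
        gcongr
        exact min_le_two_mul_mul le_add_tsub
    _ = 2 * (e * (μ A * μ Tᶜ)) + 2 * (e * μ (T \ A)) * μ A := by ring
    _ ≤ 2 * (k * μ (T \ A)) + 2 * (e * μ (T \ A)) * 1 :=
        add_le_add (mul_le_mul_right h _) (mul_le_mul_right prob_le_one _)
    _ = (2 * k + 2 * e) * μ (T \ A) := by ring

theorem inv_two_mul_le_cheeger {μ : Measure (EuclideanSpace ℝ (Fin n))} [IsProbabilityMeasure μ]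
    {k : ℝ≥0∞}
    (hμ : ∀ A, MeasurableSet A → ∀ ε, 0 < ε →
      ENNReal.ofReal ε * (μ A * μ (Metric.thickening ε A)ᶜ) ≤ k * μ (Metric.thickening ε A \ A)) :
    (2 * k)⁻¹ ≤ cheeger μ := by
  refine le_sSup fun A hA => ?_
  set m := min (μ A) (1 - μ A)
  have hm : m ≠ ⊤ := ((min_le_left _ _).trans_lt (measure_lt_top μ A)).ne
  have hlim : Tendsto (fun ε : ℝ => m / (2 * k + 2 * ENNReal.ofReal ε)) (𝓝[>] 0)
      (𝓝 (m / (2 * k + 2 * ENNReal.ofReal 0))) := by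
    refine ENNReal.Tendsto.const_div (Tendsto.mono_left ?_ nhdsWithin_le_nhds) (Or.inr hm)
    exact tendsto_const_nhds.add
      (ENNReal.Tendsto.const_mul (ENNReal.continuous_ofReal.tendsto 0) (Or.inr (by simp)))
  rw [ENNReal.ofReal_zero, mul_zero, add_zero, ENNReal.div_eq_inv_mul] at hlim
  rw [← hlim.liminf_eq]
  refine liminf_le_liminf ?_
  filter_upwards [self_mem_nhdsWithin] with ε (hε : 0 < ε)
  have hsub : A ⊆ Metric.thickening ε A := Metric.self_subset_thickening hε A
  have hbound := mul_min_le_of_mul_measure_compl_le hA Metric.isOpen_thickening.measurableSet hsub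
    (hμ A hA ε hε)
  rw [← measure_sdiff hsub hA.nullMeasurableSet (measure_ne_top μ A),
    ENNReal.le_div_iff_mul_le (Or.inl (by simpa)) (Or.inl ENNReal.ofReal_ne_top), mul_comm,
    ← mul_div_assoc]
  exact ENNReal.div_le_of_le_mul' hbound

theorem cheeger_mul_min_le (μ : Measure (EuclideanSpace ℝ (Fin n)))
    {A : Set (EuclideanSpace ℝ (Fin n))} (hA : MeasurableSet A) :
    cheeger μ * min (μ A) (1 - μ A) ≤ minkowskiContent μ A := by
  rw [cheeger, ENNReal.sSup_mul]
  exact iSup₂_le fun h hh => hh A hA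

theorem unif_eq_cond (E : Set (EuclideanSpace ℝ (Fin n))) :
    unif E = ProbabilityTheory.cond volume E :=
  rfl

theorem isProbabilityMeasure_unif {E : Set (EuclideanSpace ℝ (Fin n))} (hE₀ : volume E ≠ 0)
    (hE : volume E ≠ ⊤) : IsProbabilityMeasure (unif E) :=
  ProbabilityTheory.cond_isProbabilityMeasure_of_finite hE₀ hE

theorem inv_two_pow_mul_ediam_le_cheeger_unif {E : Set (EuclideanSpace ℝ (Fin n))}
    (hE : Convex ℝ E) (hE₀ : volume E ≠ 0) (hE' : volume E ≠ ⊤) :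
    (2 * (2 ^ n * Metric.ediam E))⁻¹ ≤ cheeger (unif E) := by
  have := isProbabilityMeasure_unif hE₀ hE'
  have hunif : ∀ B, unif E B = (volume E)⁻¹ * volume.restrict E B := fun _ => rfl
  refine inv_two_mul_le_cheeger fun A hA ε hε => ?_
  have hsep := ofReal_mul_restrict_mul_le_of_convex volume hE hA hε
  rw [finrank_euclideanSpace_fin] at hsep
  set T := Metric.thickening ε A
  calc ENNReal.ofReal ε * (unif E A * unif E Tᶜ)
      = (volume E)⁻¹ * (volume E)⁻¹ *
          (ENNReal.ofReal ε * (volume.restrict E A * volume.restrict E Tᶜ)) := by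
        rw [hunif, hunif]
        ring
    _ ≤ (volume E)⁻¹ * (volume E)⁻¹ *
          (Metric.ediam E * (2 ^ n * volume.restrict E (T \ A) * volume E)) := by gcongr
    _ = 2 ^ n * Metric.ediam E * unif E (T \ A) * ((volume E)⁻¹ * volume E) := by
        rw [hunif]
        ring
    _ = 2 ^ n * Metric.ediam E * unif E (T \ A) := by
        rw [ENNReal.inv_mul_cancel hE₀ hE', mul_one]

end Cheeger

section Transport

variable {n : ℕ} {c : EuclideanSpace ℝ (Fin n) → EuclideanSpace ℝ (Fin n) → ℝ≥0∞}
  {μ ν : Measure (EuclideanSpace ℝ (Fin n))} {s t : Set (EuclideanSpace ℝ (Fin n))} {M : ℝ≥0∞}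

theorem transportCost_le_of_forall_le [IsProbabilityMeasure μ] [IsProbabilityMeasure ν]
    (hs : ∀ᵐ x ∂μ, x ∈ s) (ht : ∀ᵐ y ∂ν, y ∈ t) (hc : ∀ x ∈ s, ∀ y ∈ t, c x y ≤ M) :
    transportCost c μ ν ≤ M := by
  refine iInf_le_of_le (μ.prod ν) (iInf_le_of_le (by simp [Measure.map_fst_prod])
    (iInf_le_of_le (by simp [Measure.map_snd_prod]) ?_))
  calc ∫⁻ p, c p.1 p.2 ∂μ.prod ν
      ≤ ∫⁻ _, M ∂μ.prod ν := by
        refine lintegral_mono_ae ?_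
        filter_upwards [Measure.quasiMeasurePreserving_fst.ae hs,
          Measure.quasiMeasurePreserving_snd.ae ht] with p hp₁ hp₂ using hc _ hp₁ _ hp₂
    _ = M := by simp

theorem measure_mul_le_transportCost (hs : ∀ᵐ x ∂μ, x ∈ s) (ht : MeasurableSet t)
    (hc : ∀ x ∈ s, ∀ y ∈ t, M ≤ c x y) : ν t * M ≤ transportCost c μ ν := by
  refine le_iInf fun π => le_iInf fun hπ₁ => le_iInf fun hπ₂ => ?_
  have hfst : ∀ᵐ p ∂π, p.1 ∈ s := by
    rw [← hπ₁] at hs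
    exact ae_of_ae_map measurable_fst.aemeasurable hs
  calc ν t * M = ∫⁻ _ in Prod.snd ⁻¹' t, M ∂π := by
        rw [setLIntegral_const, ← hπ₂, Measure.map_apply measurable_snd ht, mul_comm]
    _ ≤ ∫⁻ p in Prod.snd ⁻¹' t, c p.1 p.2 ∂π :=
        setLIntegral_mono_ae' (measurable_snd ht) (hfst.mono fun p hp hpt => hc _ hp _ hpt)
    _ ≤ ∫⁻ p, c p.1 p.2 ∂π := setLIntegral_le_lintegral _ _

theorem costF_le (t : ℝ≥0∞) : costF t ≤ t := by
  rcases eq_or_ne t ⊤ with rfl | ht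
  · exact le_top
  rw [costF, if_neg ht]
  refine ENNReal.ofReal_le_of_le_toReal ?_
  linarith [Real.log_nonneg (show 1 ≤ 1 + t.toReal by simp)]

theorem le_two_mul_costF_add_one (t : ℝ≥0∞) : t ≤ 2 * costF t + 1 := by
  rcases eq_or_ne t ⊤ with rfl | ht
  · simp [costF]
  have hlog : Real.log (1 + t.toReal) ≤ t.toReal / 2 + 1 / 2 := by
    have h := Real.log_le_sub_one_of_pos (show 0 < (1 + t.toReal) / 2 by positivity)
    rw [Real.log_div (by positivity) two_ne_zero] at h
    linarith [Real.log_two_lt_d9]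
  have hlog' := Real.log_le_sub_one_of_pos (show 0 < 1 + t.toReal by positivity)
  rw [costF, if_neg ht, ← ENNReal.ofReal_ofNat, ← ENNReal.ofReal_mul zero_le_two,
    ← ENNReal.ofReal_one, ← ENNReal.ofReal_add (by linarith) zero_le_one]
  exact (ENNReal.le_ofReal_iff_toReal_le ht (by linarith)).2 (by linarith)

theorem cheeger_mul_W1_le [IsProbabilityMeasure μ] (ρ : Measure (EuclideanSpace ℝ (Fin n))) :
    cheeger ρ * W1 μ ν ≤ 2 * transportCost (cheegerCost ρ) μ ν + 1 := by
  rw [← tsub_le_iff_right, mul_comm 2, ← ENNReal.div_le_iff two_ne_zero ENNReal.ofNat_ne_top]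
  refine le_iInf fun π => le_iInf fun hπ₁ => le_iInf fun hπ₂ => ?_
  have hπ : π univ = 1 := by
    rw [← preimage_univ (f := Prod.fst), ← Measure.map_apply measurable_fst .univ, hπ₁,
      measure_univ]
  rw [ENNReal.div_le_iff two_ne_zero ENNReal.ofNat_ne_top, mul_comm _ 2, tsub_le_iff_right]
  calc cheeger ρ * W1 μ ν
      ≤ cheeger ρ * ∫⁻ p, edist p.1 p.2 ∂π := by
        gcongr
        exact iInf_le_of_le π (iInf_le_of_le hπ₁ (iInf_le _ hπ₂))
    _ ≤ ∫⁻ p, cheeger ρ * edist p.1 p.2 ∂π := lintegral_const_mul_le _ _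
    _ ≤ ∫⁻ p, 2 * cheegerCost ρ p.1 p.2 + 1 ∂π :=
        lintegral_mono fun p => le_two_mul_costF_add_one _
    _ = 2 * (∫⁻ p, cheegerCost ρ p.1 p.2 ∂π) + 1 := by
        rw [lintegral_add_right _ measurable_const, lintegral_const_mul' _ _ ENNReal.ofNat_ne_top,
          lintegral_one, hπ]

theorem transportCost_cheegerCost_le {ρ : Measure (EuclideanSpace ℝ (Fin n))}
    (hρ₀ : cheeger ρ ≠ 0) (hρ : cheeger ρ ≠ ⊤) :
    transportCost (cheegerCost ρ) μ ν ≤ cheeger ρ * W1 μ ν := by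
  simp only [W1, transportCost, ENNReal.mul_iInf_of_ne hρ₀ hρ, ← lintegral_const_mul' _ _ hρ]
  gcongr
  exact costF_le _

end Transport

section Box

variable {n : ℕ} {a b : Fin n → ℝ}

/-- The axis-parallel box `∏ᵢ [-aᵢ, aᵢ]` in Euclidean space, given by its half side lengths. -/
def box (a : Fin n → ℝ) : Set (EuclideanSpace ℝ (Fin n)) :=
  {x | ∀ i, x i ∈ Icc (-a i) (a i)}

theorem volume_setOf_forall_mem (s : Fin n → Set ℝ) :
    volume {x : EuclideanSpace ℝ (Fin n) | ∀ i, x i ∈ s i} = ∏ i, volume (s i) := by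
  rw [← volume_pi_pi, ← (PiLp.volume_preserving_ofLp (Fin n)).measure_preimage_emb
    (MeasurableEquiv.toLp 2 (Fin n → ℝ)).symm.measurableEmbedding]
  simp only [univ_pi_eq_iInter, preimage_iInter, ofPred_forall, preimage_preimage]
  rfl

theorem measurableSet_box : MeasurableSet (box a) := by
  simp only [box, ofPred_forall]
  exact .iInter fun i => measurableSet_Icc.preimage (by fun_prop)

theorem convex_box : Convex ℝ (box a) := by
  simp only [box, ofPred_forall]
  exact convex_iInter fun i =>
    (convex_Icc _ _).linear_preimage (EuclideanSpace.proj (𝕜 := ℝ) i).toLinearMap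

theorem volume_box (ha : ∀ i, 0 ≤ a i) : volume (box a) = ENNReal.ofReal (∏ i, 2 * a i) := by
  rw [box, volume_setOf_forall_mem, ENNReal.ofReal_prod_of_nonneg fun i _ => by linarith [ha i]]
  refine Finset.prod_congr rfl fun i _ => ?_
  rw [Real.volume_Icc]
  ring_nf

theorem volume_box_ne_zero (ha : ∀ i, 0 < a i) : volume (box a) ≠ 0 := by
  rw [volume_box fun i => (ha i).le, ENNReal.ofReal_ne_zero_iff]
  exact Finset.prod_pos fun i _ => by linarith [ha i]

theorem ediam_box_le : Metric.ediam (box a) ≤ ENNReal.ofReal (2 * ‖WithLp.toLp 2 a‖) := by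
  have hnorm : ∀ x ∈ box a, ‖x‖ ≤ ‖WithLp.toLp 2 a‖ := by
    intro x hx
    rw [EuclideanSpace.norm_eq, EuclideanSpace.norm_eq]
    gcongr with i
    exact (abs_le.2 (hx i)).trans (le_abs_self _)
  refine Metric.ediam_le fun x hx y hy => ?_
  rw [edist_dist]
  refine ENNReal.ofReal_le_ofReal ((dist_le_norm_add_norm x y).trans ?_)
  linarith [hnorm x hx, hnorm y hy]

theorem isBounded_box : Bornology.IsBounded (box a) :=
  Metric.isBounded_iff_ediam_ne_top.2 (ne_top_of_le_ne_top ENNReal.ofReal_ne_top ediam_box_le)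

theorem unif_box_setOf_apply_mem (ha : ∀ i, 0 < a i) (i : Fin n) (s : Set ℝ) :
    unif (box a) {x | x i ∈ s} = volume (Icc (-a i) (a i) ∩ s) / ENNReal.ofReal (2 * a i) := by
  set side : Fin n → Set ℝ := fun j => Icc (-a j) (a j)
  have hside : ∀ j, volume (side j) = ENNReal.ofReal (2 * a j) := by
    intro j
    rw [Real.volume_Icc]
    ring_nf
  have hinter : box a ∩ {x | x i ∈ s} =
      {x | ∀ j, x j ∈ Function.update side i (side i ∩ s) j} := by
    ext x
    simp only [mem_ofPred_eq, Function.forall_update_iff side fun j t => x j ∈ t]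
    exact ⟨fun h => ⟨⟨h.1 i, h.2⟩, fun j _ => h.1 j⟩,
      fun h => ⟨fun j => (eq_or_ne j i).elim (fun hj => hj ▸ h.1.1) (h.2 j), h.1.2⟩⟩
  have hrest : ∏ j ∈ Finset.univ \ {i}, volume (side j) ≠ 0 :=
    Finset.prod_ne_zero_iff.2 fun j _ => by simp [hside, ha j]
  have hrest' : ∏ j ∈ Finset.univ \ {i}, volume (side j) ≠ ⊤ :=
    ENNReal.prod_ne_top fun j _ => hside j ▸ ENNReal.ofReal_ne_top
  have hprod : ∀ t, ∏ j, volume (Function.update side i t j) =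
      volume t * ∏ j ∈ Finset.univ \ {i}, volume (side j) := by
    intro t
    simp_rw [Function.apply_update (fun _ => volume) side i t]
    exact Finset.prod_update_of_mem (Finset.mem_univ i) _ _
  have hbox : volume (box a) = volume (side i) * ∏ j ∈ Finset.univ \ {i}, volume (side j) := by
    rw [← hprod, Function.update_eq_self]
    exact volume_setOf_forall_mem _
  rw [unif_eq_cond, ProbabilityTheory.cond_apply measurableSet_box, hinter,
    volume_setOf_forall_mem, hprod, hbox, ← hside, ← ENNReal.div_eq_inv_mul,
    ENNReal.mul_div_mul_right _ _ hrest hrest']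

theorem ae_mem_unif_box : ∀ᵐ x ∂unif (box a), x ∈ box a :=
  ProbabilityTheory.ae_cond_mem measurableSet_box

theorem isProbabilityMeasure_unif_box (ha : ∀ i, 0 < a i) : IsProbabilityMeasure (unif (box a)) :=
  isProbabilityMeasure_unif (volume_box_ne_zero ha)
    (by rw [volume_box fun i => (ha i).le]; exact ENNReal.ofReal_ne_top)

theorem minkowskiContent_unif_box_halfspace_le (ha : ∀ i, 0 < a i) (i : Fin n) :
    minkowskiContent (unif (box a)) {x | x i ∈ Iic 0} ≤ (ENNReal.ofReal (2 * a i))⁻¹ := by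
  refine liminf_le_of_frequently_le' (Frequently.of_forall fun ε => ?_)
  have hsub : Metric.thickening ε {x : EuclideanSpace ℝ (Fin n) | x i ∈ Iic 0} \
      {x | x i ∈ Iic 0} ⊆ {x | x i ∈ Ioo 0 ε} := by
    rintro x ⟨hx, hxi⟩
    obtain ⟨y, hy, hxy⟩ := Metric.mem_thickening_iff.1 hx
    have hdist := (le_abs_self _).trans_lt ((PiLp.dist_apply_le x y i).trans_lt hxy)
    exact ⟨not_le.1 hxi, by linarith [show y i ≤ 0 from hy]⟩
  refine ENNReal.div_le_of_le_mul ?_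
  calc _ ≤ unif (box a) {x | x i ∈ Ioo 0 ε} := le_measure_sdiff.trans (measure_mono hsub)
    _ ≤ volume (Ioo 0 ε) / ENNReal.ofReal (2 * a i) := by
        rw [unif_box_setOf_apply_mem ha]
        gcongr
        exact inter_subset_right
    _ = (ENNReal.ofReal (2 * a i))⁻¹ * ENNReal.ofReal ε := by
        rw [Real.volume_Ioo, sub_zero, ENNReal.div_eq_inv_mul]

theorem cheeger_unif_box_le (ha : ∀ i, 0 < a i) (i : Fin n) :
    cheeger (unif (box a)) ≤ (ENNReal.ofReal (a i))⁻¹ := by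
  have hhalf : unif (box a) {x | x i ∈ Iic 0} = 2⁻¹ := by
    have hIcc : Icc (-a i) (a i) ∩ Iic 0 = Icc (-a i) 0 := by
      rw [← Ici_inter_Iic, inter_assoc, Iic_inter_Iic, min_eq_right (ha i).le, Ici_inter_Iic]
    rw [unif_box_setOf_apply_mem ha, hIcc, Real.volume_Icc, zero_sub, neg_neg,
      ← ENNReal.ofReal_div_of_pos (by linarith [ha i]), div_mul_cancel_right₀ (ha i).ne',
      ENNReal.ofReal_inv_of_pos two_pos, ENNReal.ofReal_ofNat]
  have h := (cheeger_mul_min_le (unif (box a)) (A := {x | x i ∈ Iic 0})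
    (measurableSet_Iic.preimage (by fun_prop))).trans (minkowskiContent_unif_box_halfspace_le ha i)
  rw [hhalf, ENNReal.one_sub_inv_two, min_self, ← div_eq_mul_inv,
    ENNReal.div_le_iff two_ne_zero ENNReal.ofNat_ne_top] at h
  refine h.trans_eq ?_
  rw [ENNReal.ofReal_mul zero_le_two, ENNReal.ofReal_ofNat,
    ENNReal.mul_inv (Or.inl two_ne_zero) (Or.inl ENNReal.ofNat_ne_top), mul_right_comm,
    ENNReal.inv_mul_cancel two_ne_zero ENNReal.ofNat_ne_top, one_mul]

theorem le_W1_unif_box (hb : ∀ i, 0 < b i) (i : Fin n) :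
    4⁻¹ * ENNReal.ofReal (b i / 2 - a i) ≤ W1 (unif (box a)) (unif (box b)) := by
  have hquarter : unif (box b) {y | y i ∈ Ici (b i / 2)} = 4⁻¹ := by
    have hIcc : Icc (-b i) (b i) ∩ Ici (b i / 2) = Icc (b i / 2) (b i) := by
      rw [← Ici_inter_Iic, inter_right_comm, Ici_inter_Ici,
        sup_eq_right.2 (by linarith [hb i]), Ici_inter_Iic]
    rw [unif_box_setOf_apply_mem hb, hIcc, Real.volume_Icc,
      ← ENNReal.ofReal_div_of_pos (by linarith [hb i]), ← ENNReal.ofReal_ofNat,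
      ← ENNReal.ofReal_inv_of_pos four_pos]
    congr 1
    field [(hb i).ne']
  rw [← hquarter]
  refine measure_mul_le_transportCost ae_mem_unif_box
    (measurableSet_Ici.preimage (by fun_prop)) fun x hx y hy => ?_
  rw [edist_comm, edist_dist]
  refine ENNReal.ofReal_le_ofReal (le_trans ?_ (PiLp.dist_apply_le y x i))
  exact (sub_le_sub hy (hx i).2).trans (le_abs_self _)

theorem W1_unif_box_ne_top (ha : ∀ i, 0 < a i) (hb : ∀ i, 0 < b i) :
    W1 (unif (box a)) (unif (box b)) ≠ ⊤ := by
  have := isProbabilityMeasure_unif_box ha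
  have := isProbabilityMeasure_unif_box hb
  refine ne_top_of_le_ne_top ((isBounded_box (a := a)).union (isBounded_box (a := b))).ediam_ne_top
    (transportCost_le_of_forall_le ae_mem_unif_box ae_mem_unif_box fun x hx y hy => ?_)
  exact Metric.edist_le_ediam_of_mem (Or.inl hx) (Or.inr hy)

theorem box_add_box (ha : ∀ i, 0 ≤ a i) (hb : ∀ i, 0 ≤ b i) : box a + box b = box (a + b) := by
  have hIcc : ∀ i, Icc (-a i) (a i) + Icc (-b i) (b i) = Icc (-(a i + b i)) (a i + b i) := by
    intro i
    rw [Icc_add_Icc (by linarith [ha i]) (by linarith [hb i]), neg_add]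
  refine Subset.antisymm ?_ fun z hz => ?_
  · rintro _ ⟨x, hx, y, hy, rfl⟩ i
    exact (hIcc i).subset (add_mem_add (hx i) (hy i))
  · choose u hu v hv huv using fun i => (hIcc i).superset (hz i)
    exact ⟨WithLp.toLp 2 u, hu, WithLp.toLp 2 v, hv, PiLp.ext huv⟩

theorem smul_box {r : ℝ} (hr : 0 < r) : r • box a = box (r • a) := by
  ext x
  simp only [mem_smul_set_iff_inv_smul_mem₀ hr.ne', box, mem_ofPred_eq, PiLp.smul_apply,
    Pi.smul_apply, smul_eq_mul, mem_Icc]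
  refine forall_congr' fun i => and_congr ?_ ?_
  · rw [← mul_neg, le_inv_mul_iff₀ hr]
  · rw [inv_mul_le_iff₀ hr]

theorem perimeter_box (ha : ∀ i, 0 ≤ a i) (hb : ∀ i, 0 ≤ b i) :
    perimeter (box b) (box a) =
      ENNReal.ofReal (∑ i, (∏ j ∈ Finset.univ.erase i, 2 * a j) * (2 * b i)) := by
  set vol : ℝ → ℝ := fun ε => ∏ i, 2 * (a i + ε * b i)
  have hderiv : HasDerivAt vol (∑ i, (∏ j ∈ Finset.univ.erase i, 2 * a j) * (2 * b i)) 0 := by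
    have hside : ∀ i ∈ Finset.univ,
        HasDerivAt (fun ε => 2 * (a i + ε * b i)) (2 * b i) (0 : ℝ) := fun i _ => by
      simpa using (((hasDerivAt_id (0 : ℝ)).mul_const (b i)).const_add (a i)).const_mul 2
    simpa using HasDerivAt.fun_finsetProd hside
  have hvol : ∀ ε > 0, volume (box a + ε • box b) = ENNReal.ofReal (vol ε) := by
    intro ε hε
    have hεb : ∀ i, 0 ≤ (ε • b) i := fun i => mul_nonneg hε.le (hb i)
    have hab : ∀ i, 0 ≤ (a + ε • b) i := fun i => add_nonneg (ha i) (hεb i)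
    rw [smul_box hε, box_add_box ha hεb, volume_box hab]
    rfl
  have hvol₀ : volume (box a) = ENNReal.ofReal (vol 0) := by simp [volume_box ha, vol]
  refine Tendsto.liminf_eq
    ((ENNReal.tendsto_ofReal hderiv.tendsto_slope_zero_right).congr' ?_)
  filter_upwards [self_mem_nhdsWithin] with ε (hε : 0 < ε)
  have hvol₀_nonneg : 0 ≤ vol 0 := Finset.prod_nonneg fun i _ => by simpa using ha i
  rw [hvol ε hε, hvol₀, ← ENNReal.ofReal_sub _ hvol₀_nonneg, ← ENNReal.ofReal_div_of_pos hε,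
    zero_add, smul_eq_mul, inv_mul_eq_div]

end Box

section Remainders

variable {n : ℕ}

theorem asymmetry_le_two {E K : Set (EuclideanSpace ℝ (Fin n))} {r : ℝ} (hr : 0 < r)
    (h : ENNReal.ofReal r ^ n * volume K = volume E) : asymmetry K E ≤ 2 := by
  have hsmul : volume (r • K) = volume E := by
    rw [Measure.addHaar_smul_of_nonneg _ hr.le, finrank_euclideanSpace_fin,
      ENNReal.ofReal_pow hr.le, h]
  refine (iInf₂_le_of_le 0 r (iInf₂_le hr h)).trans ?_
  calc volume (symmDiff E ((0 : EuclideanSpace ℝ (Fin n)) +ᵥ r • K)) / volume E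
      ≤ (volume E + volume E) / volume E := by
        gcongr
        rw [zero_vadd]
        refine (measure_mono symmDiff_le_sup).trans ((measure_union_le _ _).trans_eq ?_)
        rw [hsmul]
    _ = 2 * (volume E / volume E) := by rw [← two_mul, mul_div_assoc]
    _ ≤ 2 := mul_le_of_le_one_right' ENNReal.div_self_le_one

theorem tendsto_toReal_const_mul_atTop {ι : Type*} {l : Filter ι} {k : ℝ≥0∞} {f t : ι → ℝ≥0∞}
    (hk₀ : k ≠ 0) (hk : k ≠ ⊤) (hft : ∀ᶠ i in l, f i ≤ t i) (htf : ∀ᶠ i in l, t i ≤ 2 * f i + 1)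
    (ht : Tendsto (fun i => (t i).toReal) l atTop) :
    Tendsto (fun i => (k * f i).toReal) l atTop := by
  simp only [ENNReal.toReal_mul]
  refine Tendsto.const_mul_atTop (ENNReal.toReal_pos hk₀ hk) ?_
  have hlower : Tendsto (fun i => ((t i).toReal - 1) / 2) l atTop :=
    (tendsto_atTop_add_const_right _ (-1) ht).atTop_div_const two_pos
  refine tendsto_atTop_mono' l ?_ hlower
  filter_upwards [hft, htf, ht.eventually_gt_atTop 0] with i hi hi' hpos
  have hf : f i ≠ ⊤ := ne_top_of_le_ne_top (ENNReal.toReal_pos_iff.1 hpos).2.ne hi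
  have h := ENNReal.toReal_mono (by finiteness) hi'
  rw [ENNReal.toReal_add (by finiteness) ENNReal.one_ne_top, ENNReal.toReal_mul,
    ENNReal.toReal_ofNat, ENNReal.toReal_one] at h
  linarith

theorem normalized_eq_self {E : Set (EuclideanSpace ℝ (Fin n))} (hE : volume E = 1) :
    normalized E = E := by
  simp [normalized, hE]

variable [NeZero n] {ι : Type*} {l : Filter ι} {E K : ι → Set (EuclideanSpace ℝ (Fin n))}
  {c : ℝ≥0}

theorem tendsto_distRemainder_atTop (hc : 0 < c)
    (h : Tendsto (fun i => (cheeger (unif (E i)) * W1 (unif (E i)) (unif (K i))).toReal) l atTop) :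
    Tendsto (fun i => (distRemainder c (E i) (K i)).toReal) l atTop :=
  tendsto_toReal_const_mul_atTop (by simp [hc.ne']) (by simp [ENNReal.div_eq_top, NeZero.ne n])
    (.of_forall fun _ => costF_le _) (.of_forall fun _ => le_two_mul_costF_add_one _) h

theorem tendsto_costRemainder_atTop (hc : 0 < c) (hE : ∀ᶠ i in l, volume (E i) = 1)
    (hK : ∀ᶠ i in l, volume (K i) = 1)
    (h : Tendsto (fun i => (cheeger (unif (E i)) * W1 (unif (E i)) (unif (K i))).toReal) l atTop) :
    Tendsto (fun i => (costRemainder c (E i) (K i)).toReal) l atTop := by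
  refine tendsto_toReal_const_mul_atTop (by simp [hc.ne'])
    (by simp [ENNReal.div_eq_top, NeZero.ne n]) ?_ ?_ h
  · filter_upwards [hE, hK, h.eventually_gt_atTop 0] with i hEi hKi hpos
    rw [ENNReal.toReal_mul] at hpos
    have hcheeger := ENNReal.toReal_pos_iff.1 (pos_of_mul_pos_left hpos ENNReal.toReal_nonneg)
    rw [normalized_eq_self hEi, normalized_eq_self hKi]
    exact transportCost_cheegerCost_le hcheeger.1.ne' hcheeger.2.ne
  · filter_upwards [hE, hK] with i hEi hKi
    have := isProbabilityMeasure_unif (E := E i) (by simp [hEi]) (by simp [hEi])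
    rw [normalized_eq_self hEi, normalized_eq_self hKi]
    exact cheeger_mul_W1_le _

end Remainders

section Rectangles

variable {α : ℝ}

theorem rectE_eq_box (α : ℝ) : rectE α = box ![α / 2, 1 / (2 * α)] := by
  ext x
  simp [rectE, box, Fin.forall_fin_two]

theorem rectK_eq_rectE_sq (α : ℝ) : rectK α = rectE (α ^ 2) :=
  rfl

theorem rect_half_sides_pos (hα : 0 < α) (i : Fin 2) : 0 < ![α / 2, 1 / (2 * α)] i := by
  fin_cases i
  · exact half_pos hα
  · exact one_div_pos.2 (mul_pos two_pos hα)

theorem volume_rectE (hα : 0 < α) : volume (rectE α) = 1 := by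
  rw [rectE_eq_box, volume_box fun i => (rect_half_sides_pos hα i).le, Fin.prod_univ_two]
  simp only [Matrix.cons_val_zero, Matrix.cons_val_one]
  rw [← ENNReal.ofReal_one]
  congr 1
  field

theorem ediam_rectE_le (hα : 1 ≤ α) : Metric.ediam (rectE α) ≤ ENNReal.ofReal (2 * α) := by
  rw [rectE_eq_box]
  refine ediam_box_le.trans (ENNReal.ofReal_le_ofReal ?_)
  gcongr
  rw [EuclideanSpace.norm_eq, Fin.sum_univ_two]
  refine Real.sqrt_le_iff.2 ⟨by linarith, ?_⟩
  have hinv : 1 / (2 * α) ≤ α / 2 := by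
    rw [div_le_div_iff₀ (by linarith) two_pos]
    nlinarith
  have hinv₀ : 0 ≤ 1 / (2 * α) := by positivity
  simp only [Matrix.cons_val_zero, Matrix.cons_val_one, Real.norm_eq_abs, sq_abs]
  nlinarith

theorem ofReal_inv_le_cheeger_unif_rectE (hα : 1 ≤ α) :
    ENNReal.ofReal (16 * α)⁻¹ ≤ cheeger (unif (rectE α)) := by
  have hvol := volume_rectE (one_pos.trans_le hα)
  have hconvex : Convex ℝ (rectE α) := rectE_eq_box α ▸ convex_box
  refine le_trans ?_
    (inv_two_pow_mul_ediam_le_cheeger_unif hconvex (by simp [hvol]) (by simp [hvol]))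
  rw [ENNReal.ofReal_inv_of_pos (by linarith), ENNReal.inv_le_inv]
  calc 2 * (2 ^ 2 * Metric.ediam (rectE α))
      ≤ 2 * (2 ^ 2 * ENNReal.ofReal (2 * α)) := by gcongr; exact ediam_rectE_le hα
    _ = ENNReal.ofReal (16 * α) := by
        rw [← mul_assoc, ← ENNReal.ofReal_ofNat 2, ← ENNReal.ofReal_pow zero_le_two,
          ← ENNReal.ofReal_mul zero_le_two, ← ENNReal.ofReal_mul (by norm_num)]
        congr 1
        ring

theorem cheeger_unif_rectE_ne_top (hα : 0 < α) : cheeger (unif (rectE α)) ≠ ⊤ := by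
  have hside := rect_half_sides_pos hα
  rw [rectE_eq_box]
  refine ne_top_of_le_ne_top ?_ (cheeger_unif_box_le hside 0)
  exact ENNReal.inv_ne_top.2 (ENNReal.ofReal_pos.2 (hside 0)).ne'

theorem le_W1_unif_rect (hα : 0 < α) :
    ENNReal.ofReal ((α ^ 2 / 2 / 2 - α / 2) / 4) ≤ W1 (unif (rectE α)) (unif (rectK α)) := by
  rw [rectK_eq_rectE_sq, rectE_eq_box, rectE_eq_box]
  refine le_trans (le_of_eq ?_) (le_W1_unif_box (rect_half_sides_pos (pow_pos hα 2)) 0)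
  rw [ENNReal.ofReal_div_of_pos four_pos, ENNReal.div_eq_inv_mul, ENNReal.ofReal_ofNat]
  rfl

theorem W1_unif_rect_ne_top (hα : 0 < α) : W1 (unif (rectE α)) (unif (rectK α)) ≠ ⊤ := by
  rw [rectK_eq_rectE_sq, rectE_eq_box, rectE_eq_box]
  exact W1_unif_box_ne_top (rect_half_sides_pos hα) (rect_half_sides_pos (pow_pos hα 2))

theorem tendsto_cheeger_mul_W1_rect_atTop :
    Tendsto (fun α : ℝ => (cheeger (unif (rectE α)) * W1 (unif (rectE α)) (unif (rectK α))).toReal)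
      atTop atTop := by
  have hlinear : Tendsto (fun α : ℝ => (α - 2) / 256) atTop atTop :=
    (tendsto_atTop_add_const_right _ (-2) tendsto_id).atTop_div_const (by norm_num)
  refine tendsto_atTop_mono' _ ?_ hlinear
  filter_upwards [eventually_ge_atTop 1] with α hα
  have hα₀ : 0 < α := one_pos.trans_le hα
  rw [← ENNReal.ofReal_le_iff_le_toReal
    (ENNReal.mul_ne_top (cheeger_unif_rectE_ne_top hα₀) (W1_unif_rect_ne_top hα₀))]
  calc ENNReal.ofReal ((α - 2) / 256)
      = ENNReal.ofReal (16 * α)⁻¹ * ENNReal.ofReal ((α ^ 2 / 2 / 2 - α / 2) / 4) := by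
        rw [← ENNReal.ofReal_mul (by positivity)]
        congr 1
        field
    _ ≤ _ := mul_le_mul' (ofReal_inv_le_cheeger_unif_rectE hα) (le_W1_unif_rect hα₀)

theorem deficit_rect (hα : 0 < α) : deficit (rectE α) (rectK α) = (α + α⁻¹) / 2 - 1 := by
  have hperimeter : perimeter (rectK α) (rectE α) = ENNReal.ofReal (α + α⁻¹) := by
    rw [rectK_eq_rectE_sq, rectE_eq_box, rectE_eq_box,
      perimeter_box (fun i => (rect_half_sides_pos hα i).le)
        fun i => (rect_half_sides_pos (pow_pos hα 2) i).le]
    have h₀ : Finset.univ.erase (0 : Fin 2) = {1} := rfl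
    have h₁ : Finset.univ.erase (1 : Fin 2) = {0} := rfl
    rw [Fin.sum_univ_two, h₀, h₁, Finset.prod_singleton, Finset.prod_singleton]
    simp only [Matrix.cons_val_zero, Matrix.cons_val_one]
    congr 1
    field
  rw [deficit, hperimeter, rectK_eq_rectE_sq, volume_rectE hα, volume_rectE (pow_pos hα 2),
    ENNReal.toReal_ofReal (by positivity)]
  simp

theorem tendsto_deficit_rect_atTop :
    Tendsto (fun α : ℝ => deficit (rectE α) (rectK α)) atTop atTop := by
  have hlower : Tendsto (fun α : ℝ => α / 2 - 1) atTop atTop :=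
    tendsto_atTop_add_const_right _ (-1) (tendsto_id.atTop_div_const two_pos)
  refine tendsto_atTop_mono' _ ?_ hlower
  filter_upwards [eventually_gt_atTop 0] with α hα
  rw [deficit_rect hα]
  linarith [inv_pos.2 hα]

theorem fmpRemainder_rect_le (C : ℝ≥0) (hα : 0 < α) :
    fmpRemainder C (rectE α) (rectK α) ≤ C / 2 ^ 7 * 2 ^ 2 := by
  have hvol : ENNReal.ofReal 1 ^ 2 * volume (rectK α) = volume (rectE α) := by
    rw [rectK_eq_rectE_sq, volume_rectE hα, volume_rectE (pow_pos hα 2)]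
    simp
  rw [fmpRemainder, Nat.cast_ofNat]
  gcongr
  exact asymmetry_le_two one_pos hvol

end Rectangles

end QuantIso

/-- The limits are taken of real numbers: since `∞.toReal = 0`, each of the first three limits also
contains the finiteness of its quantity for all large `α`. -/
theorem mainTheorem3 :
    Tendsto (fun α : ℝ =>
      (QuantIso.cheeger (QuantIso.unif (QuantIso.rectE α)) *
        QuantIso.W1 (QuantIso.unif (QuantIso.rectE α))
          (QuantIso.unif (QuantIso.rectK α))).toReal) atTop atTop ∧
    (∀ c : ℝ≥0, 0 < c →
      Tendsto (fun α : ℝ =>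
        (QuantIso.distRemainder c (QuantIso.rectE α) (QuantIso.rectK α)).toReal) atTop atTop ∧
      Tendsto (fun α : ℝ =>
        (QuantIso.costRemainder c (QuantIso.rectE α) (QuantIso.rectK α)).toReal) atTop atTop) ∧
    Tendsto (fun α : ℝ => QuantIso.deficit (QuantIso.rectE α) (QuantIso.rectK α)) atTop atTop ∧
    (∀ C : ℝ≥0, ∃ M : ℝ≥0, ∀ α : ℝ, 0 < α →
      QuantIso.fmpRemainder C (QuantIso.rectE α) (QuantIso.rectK α) ≤ (M : ℝ≥0∞)) := by
  have hvolE : ∀ᶠ α in atTop, volume (QuantIso.rectE α) = 1 :=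
    (eventually_gt_atTop 0).mono fun _ => QuantIso.volume_rectE
  have hvolK : ∀ᶠ α in atTop, volume (QuantIso.rectK α) = 1 :=
    (eventually_gt_atTop 0).mono fun α hα => QuantIso.volume_rectE (pow_pos hα 2)
  have hdist := QuantIso.tendsto_cheeger_mul_W1_rect_atTop
  refine ⟨hdist, fun c hc => ⟨QuantIso.tendsto_distRemainder_atTop hc hdist,
    QuantIso.tendsto_costRemainder_atTop hc hvolE hvolK hdist⟩,
    QuantIso.tendsto_deficit_rect_atTop, fun C => ?_⟩
  refine ⟨C / 2 ^ 7 * 2 ^ 2, fun α hα => (QuantIso.fmpRemainder_rect_le C hα).trans_eq ?_⟩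
  push_cast
  rfl
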